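/- Let $\mathcal{M}$ be an infinite first-order structure (in an arbitrary language), with universe $M$, and let $(I,<)$ be a nonempty linear order. Then there are a proper elementary extension $\mathcal{M}^{*}$ of $\mathcal{M}$, with universe $M^{*}$, and an injective group homomorphism $\alpha\mapsto\widehat{\alpha}$ from the group $\mathrm{Aut}(I,<)$ of order automorphisms of $I$ into the automorphism group $\mathrm{Aut}(\mathcal{M}^{*})$ such that: 1. for every $\alpha\in\mathrm{Aut}(I,<)$, $\widehat{\alpha}(m)=m$ for all $m\in M$; 2. for every $\alpha\in\mathrm{Aut}(I,<)$ that is fixed point free (i.e. $\alpha(i)\neq i$ for all $i\in I$), $\widehat{\alpha}(y)\neq y$ for all $y\in M^{*}\setminus M$. -/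

import Mathlib

open scoped FirstOrder

universe u v w x

namespace FirstOrder.Language

/-- The automorphism group `Aut(M)` of a first-order structure `M`: the isomorphisms of `M` onto
itself under composition, `(g * h) a = g (h a)`. -/
instance autGroup (L : FirstOrder.Language.{u, v}) (M : Type w) [L.Structure M] :
    Group (M ≃[L] M) where
  mul g h := g.comp h
  one := FirstOrder.Language.Equiv.refl L M
  inv g := g.symm
  mul_assoc _ _ _ := rfl
  one_mul _ := rfl
  mul_one _ := rfl
  inv_mul_cancel g := FirstOrder.Language.Equiv.ext fun a => g.symm_apply_apply a

end FirstOrder.Language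

/-!
The extension is the ultrapower of `M` along a nonprincipal ultrafilter on `ℕ`, iterated along the
linear order `I`. Its elements are represented by functions `f : (I → ℕ) → M` that depend on
finitely many coordinates only, and "almost everywhere" for a property depending on the coordinates
`i₁ < ⋯ < iₖ` means: for almost all values of `i₁`, …, for almost all values of `iₖ`. Dummy
coordinates do not matter (`eventually_iter_of_sublist`), so all these finite iterations are traces
of a single ultrafilter `limitUltrafilter I` on `I → ℕ`. The extension is therefore a substructure of
an ordinary ultrapower of `M`, and it is elementary by the Tarski–Vaught test: Łoś's theorem gives a
witness pointwise, as a function of the parameters, so the witness depends on finitely many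
coordinates again (`isElementary_iteratedUltrapower`).

Only the order of the coordinates enters the definition of "almost everywhere", so an order
automorphism `α` of `I` acts by `f ↦ (y ↦ f (y ∘ α))` (`eventually_limitUltrafilter_comp`,
`actionHom`), and it fixes the constants, which form the copy of `M`.

The main point is `exists_eventually_iter_eq_const`: if `f` and `g` depend on disjoint finite
sets of coordinates and agree almost everywhere, then they are almost everywhere equal to a
constant. Given a fixed point free `α` and `f` depending on `S`, some power `α ^ m` moves `S` off
itself, because all orbits of `α` are infinite. If `α` fixes the class of `f`, so does `α ^ m`, and
then `f` and its image depend on disjoint sets, so the class of `f` lies in `M`. The same lemma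
shows that distinct coordinates give distinct elements, which makes the action faithful, and
nonprincipality shows that a coordinate is not a constant, which makes the extension proper.
-/

namespace IteratedUltrapower

open Filter Function

/-! ### Iterated ultrafilters on assignments -/

/-- The iterated ultrafilter on assignments `I → ℕ` along the list `[i₁, …, iₖ]` with base point
`x`: a property holds almost everywhere when, for `U`-almost all `n₁`, …, for `U`-almost all `nₖ`,
it holds of the assignment obtained from `x` by giving `i₁, …, iₖ` the values `n₁, …, nₖ`. -/
noncomputable def iter {I : Type*} [DecidableEq I] (U : Ultrafilter ℕ) :
    List I → (I → ℕ) → Ultrafilter (I → ℕ)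
  | [], x => pure x
  | i :: l, x => U.bind fun n => iter U l (update x i n)

section iter

variable {I : Type*} [DecidableEq I] {U : Ultrafilter ℕ}

theorem eventually_iter_nil {x : I → ℕ} {P : (I → ℕ) → Prop} :
    (∀ᶠ y in iter U [] x, P y) ↔ P x := Iff.rfl

theorem eventually_iter_cons {i : I} {l : List I} {x : I → ℕ} {P : (I → ℕ) → Prop} :
    (∀ᶠ y in iter U (i :: l) x, P y) ↔ ∀ᶠ n in U, ∀ᶠ y in iter U l (update x i n), P y :=
  Iff.rfl

theorem dependsOn_eventually_iter {P : (I → ℕ) → Prop} {s : Set I} (hP : DependsOn P s)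
    (l : List I) : DependsOn (fun x => ∀ᶠ y in iter U l x, P y) (s \ {i | i ∈ l}) := by
  induction l with
  | nil => simpa [eventually_iter_nil] using hP
  | cons i l ih =>
    intro x y hxy
    simp only [eventually_iter_cons]
    refine propext (eventually_congr (Eventually.of_forall fun n => Iff.of_eq (ih fun j hj => ?_)))
    by_cases hji : j = i
    · subst hji; simp
    · simpa [hji] using hxy j ⟨hj.1, by simpa [hji] using hj.2⟩

theorem eventually_iter_update {P : (I → ℕ) → Prop} {s : Set I} (hP : DependsOn P s)
    (l : List I) {i : I} (hi : i ∉ s) (x : I → ℕ) (n : ℕ) :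
    (∀ᶠ y in iter U l (update x i n), P y) ↔ ∀ᶠ y in iter U l x, P y :=
  Iff.of_eq <| dependsOn_eventually_iter hP l fun j hj => by
    rw [update_of_ne]; rintro rfl; exact hi hj.1

/-- Coordinates on which a property does not depend can be dropped from the iteration. -/
theorem eventually_iter_of_sublist {P : (I → ℕ) → Prop} {s : Set I} (hP : DependsOn P s)
    {l l' : List I} (hl : l.Sublist l') (hnd : l'.Nodup) (hs : ∀ i ∈ s, i ∈ l' → i ∈ l)
    (x : I → ℕ) : (∀ᶠ y in iter U l' x, P y) ↔ ∀ᶠ y in iter U l x, P y := by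
  induction hl generalizing x with
  | slnil => rfl
  | @cons l l' i hl ih =>
    rw [List.nodup_cons] at hnd
    have hi : i ∉ s := fun h => hnd.1 (hl.subset (hs i h (by simp)))
    rw [eventually_iter_cons]
    simp only [eventually_iter_update hP l' hi, eventually_const]
    exact ih hnd.2 (fun j hj hj' => hs j hj (by simp [hj'])) x
  | @cons_cons l l' i hl ih =>
    rw [List.nodup_cons] at hnd
    simp only [eventually_iter_cons]
    refine eventually_congr (Eventually.of_forall fun n => ih hnd.2 (fun j hj hj' => ?_) _)
    have := hs j hj (by simp [hj'])
    rcases List.mem_cons.1 this with rfl | h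
    · exact absurd hj' hnd.1
    · exact h

theorem eventually_iter_map (α : Equiv.Perm I) (P : (I → ℕ) → Prop) (l : List I) (x : I → ℕ) :
    (∀ᶠ y in iter U (l.map α) x, P (y ∘ α)) ↔ ∀ᶠ y in iter U l (x ∘ α), P y := by
  induction l generalizing x with
  | nil => rfl
  | cons i l ih =>
    simp only [List.map_cons, eventually_iter_cons, ih]
    simp only [update_comp_equiv, Equiv.symm_apply_apply]

/-- Two almost everywhere equal functions that have no coordinate in common are almost everywhere
equal to a constant. -/
theorem exists_eventually_iter_eq_const {M : Type*} {f g : (I → ℕ) → M} {s t : Set I}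
    (hf : DependsOn f s) (hg : DependsOn g t) (hst : Disjoint s t) (l : List I) (x : I → ℕ)
    (h : ∀ᶠ y in iter U l x, f y = g y) :
    ∃ c, (∀ᶠ y in iter U l x, f y = c) ∧ ∀ᶠ y in iter U l x, g y = c := by
  have hPf (c : M) : DependsOn (fun y => f y = c) s := fun a b hab => by simp only [hf hab]
  have hPg (c : M) : DependsOn (fun y => g y = c) t := fun a b hab => by simp only [hg hab]
  induction l generalizing x with
  | nil => exact ⟨g x, h, rfl⟩
  | cons i l ih =>
    simp only [eventually_iter_cons] at h ⊢
    obtain ⟨n, hn⟩ := h.exists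
    obtain ⟨c, hfc, hgc⟩ := ih _ hn
    refine ⟨c, ?_⟩
    -- The function not depending on `i` is constant along every branch, with the same value `c`.
    by_cases hi : i ∈ s
    · have hit : i ∉ t := hst.notMem_of_mem_left hi
      rw [eventually_iter_update (hPg c) l hit] at hgc
      have hg' : ∀ n, ∀ᶠ y in iter U l (update x i n), g y = c :=
        fun n => (eventually_iter_update (hPg c) l hit x n).2 hgc
      refine ⟨?_, Eventually.of_forall hg'⟩
      filter_upwards [h] with m hm
      filter_upwards [hm, hg' m] with y h1 h2 using h1.trans h2
    · rw [eventually_iter_update (hPf c) l hi] at hfc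
      have hf' : ∀ n, ∀ᶠ y in iter U l (update x i n), f y = c :=
        fun n => (eventually_iter_update (hPf c) l hi x n).2 hfc
      refine ⟨Eventually.of_forall hf', ?_⟩
      filter_upwards [h] with m hm
      filter_upwards [hm, hf' m] with y h1 h2 using h1.symm.trans h2

end iter

/-- An ultrafilter on the assignments `I → ℕ` which, on properties depending on finitely many
coordinates, is the iteration of a nonprincipal ultrafilter along those coordinates in increasing
order. It is a limit of the finite iterations along the directed set of finite subsets of `I`; its
values on other properties play no role. -/
noncomputable def limitUltrafilter (I : Type*) [LinearOrder I] : Ultrafilter (I → ℕ) :=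
  (Ultrafilter.of (atTop : Filter (Finset I))).bind fun S => iter (hyperfilter ℕ) S.sort 0

section limit

variable {I : Type*} [LinearOrder I]

theorem eventually_limitUltrafilter {P : (I → ℕ) → Prop} {S : Finset I} (hP : DependsOn P S) :
    (∀ᶠ y in limitUltrafilter I, P y) ↔ ∀ᶠ y in iter (hyperfilter ℕ) S.sort 0, P y := by
  have key : ∀ᶠ T in (Ultrafilter.of (atTop : Filter (Finset I)) : Filter (Finset I)),
      ((∀ᶠ y in iter (hyperfilter ℕ) T.sort 0, P y) ↔
        ∀ᶠ y in iter (hyperfilter ℕ) S.sort 0, P y) := by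
    refine Ultrafilter.of_le _ ((eventually_ge_atTop S).mono fun T hST => ?_)
    refine eventually_iter_of_sublist hP ?_ (T.sort_nodup _) (fun i hi _ => by simpa using hi) 0
    exact List.sublist_of_subperm_of_sortedLE
      ((S.sort_nodup _).subperm fun i hi => by simpa using hST (by simpa using hi))
      S.sortedLT_sort.sortedLE T.sortedLT_sort.sortedLE
  change (∀ᶠ T in (Ultrafilter.of (atTop : Filter (Finset I)) : Filter (Finset I)),
    ∀ᶠ y in iter (hyperfilter ℕ) T.sort 0, P y) ↔ _
  rw [eventually_congr key, eventually_const]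

theorem dependsOn_comp_orderIso {β : Type*} {f : (I → ℕ) → β} {S : Finset I} (hf : DependsOn f S)
    (α : I ≃o I) : DependsOn (fun y => f (y ∘ α)) (S.map α.toEquiv.toEmbedding : Finset I) :=
  fun x y hxy => hf fun i hi => hxy (α i) (by simpa using hi)

/-- On properties depending on finitely many coordinates, the limit ultrafilter is invariant under
order automorphisms of the index set. -/
theorem eventually_limitUltrafilter_comp {P : (I → ℕ) → Prop} {S : Finset I}
    (hP : DependsOn P S) (α : I ≃o I) :
    (∀ᶠ y in limitUltrafilter I, P (y ∘ α)) ↔ ∀ᶠ y in limitUltrafilter I, P y := by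
  rw [eventually_limitUltrafilter hP,
    eventually_limitUltrafilter (dependsOn_comp_orderIso hP α)]
  have : (S.map α.toEquiv.toEmbedding).sort = S.sort.map α.toEquiv :=
    (Finset.map_sort _ S _ _ fun a _ b _ => (α.le_iff_le).symm).symm
  rw [this]
  exact eventually_iter_map α.toEquiv P S.sort 0

theorem exists_eventually_limitUltrafilter_eq_const {M : Type*} {f g : (I → ℕ) → M}
    {S T : Finset I} (hf : DependsOn f S) (hg : DependsOn g T) (hST : Disjoint S T)
    (h : ∀ᶠ y in limitUltrafilter I, f y = g y) :
    ∃ c, ∀ᶠ y in limitUltrafilter I, f y = c := by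
  have hfg : DependsOn (fun y => f y = g y) (S ∪ T : Finset I) := fun a b hab => by
    simp only [hf fun i hi => hab i (by simp_all), hg fun i hi => hab i (by simp_all)]
  rw [eventually_limitUltrafilter hfg] at h
  obtain ⟨c, hc, -⟩ :=
    exists_eventually_iter_eq_const hf hg (by exact_mod_cast hST) _ _ h
  refine ⟨c, (eventually_limitUltrafilter (S := S ∪ T) fun a b hab => ?_).2 hc⟩
  simp only [hf fun i hi => hab i (by simp_all)]

/-- Each coordinate is nonprincipally distributed. -/
theorem not_eventually_limitUltrafilter_apply_eq (i : I) (n : ℕ) :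
    ¬ ∀ᶠ y : I → ℕ in limitUltrafilter I, y i = n := by
  have hP : DependsOn (fun y : I → ℕ => y i = n) ({i} : Finset I) := fun a b hab => by
    simp only [hab i (by simp)]
  rw [eventually_limitUltrafilter hP]
  simp only [Finset.sort_singleton, eventually_iter_cons, eventually_iter_nil, update_self]
  exact fun h => notMem_hyperfilter_of_finite (Set.finite_singleton n) h

end limit

/-- A fixed point free order automorphism has an iterate which moves a given finite set off
itself, as its orbits are infinite. -/
theorem exists_iterate_disjoint {I : Type*} [LinearOrder I] (α : I ≃o I) (hα : ∀ i, α i ≠ i)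
    (S : Finset I) : ∃ m : ℕ, Disjoint S (S.map (α ^ m : I ≃o I).toEquiv.toEmbedding) := by
  have hpow (m : ℕ) (i : I) : (α ^ m) i = α^[m] i := by
    induction m with
    | zero => rfl
    | succ m ih => rw [pow_succ', iterate_succ_apply', ← ih]; rfl
  have hinj (i : I) : Injective fun m : ℕ => α^[m] i := by
    rcases lt_or_gt_of_ne (hα i) with h | h
    · exact (α.strictMono.strictAnti_iterate_of_map_lt h).injective
    · exact (α.strictMono.strictMono_iterate_of_lt_map h).injective
  have hfin : (⋃ s ∈ S, ⋃ t ∈ S, {m : ℕ | α^[m] s = t}).Finite :=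
    S.finite_toSet.biUnion fun s _ => S.finite_toSet.biUnion fun t _ =>
      Set.Subsingleton.finite fun a ha b hb => hinj s (ha.trans hb.symm)
  obtain ⟨m, hm⟩ := hfin.exists_notMem
  refine ⟨m, Finset.disjoint_left.2 fun t ht ht' => hm ?_⟩
  obtain ⟨s, hs, hst⟩ := Finset.mem_map.1 ht'
  simp only [Set.mem_iUnion]
  exact ⟨s, hs, t, ht, (hpow m s).symm.trans hst⟩

/-! ### Functions of finitely many coordinates -/

section FinDep

variable {I : Type*}

/-- The function `f` depends on finitely many coordinates. -/
def FinDep {β : Type*} (f : (I → ℕ) → β) : Prop := ∃ S : Finset I, DependsOn f S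

theorem FinDep.const {β : Type*} (b : β) : FinDep fun _ : I → ℕ => b :=
  ⟨∅, fun _ _ _ => rfl⟩

theorem FinDep.apply (i : I) {β : Type*} (e : ℕ → β) : FinDep fun y : I → ℕ => e (y i) :=
  ⟨{i}, fun a b hab => by simp only [hab i (by simp)]⟩

theorem FinDep.comp_orderIso [LinearOrder I] {β : Type*} {f : (I → ℕ) → β} (hf : FinDep f)
    (α : I ≃o I) : FinDep fun y => f (y ∘ α) :=
  let ⟨_, hS⟩ := hf
  ⟨_, dependsOn_comp_orderIso hS α⟩

theorem FinDep.pi {n : ℕ} {β : Type*} {f : Fin n → (I → ℕ) → β} (hf : ∀ k, FinDep (f k)) :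
    FinDep fun y k => f k y := by
  classical
  choose S hS using hf
  exact ⟨Finset.univ.biUnion S, fun a b hab =>
    funext fun k => hS k fun i hi => hab i (by simpa using ⟨k, hi⟩)⟩

theorem FinDep.map {β γ : Type*} {f : (I → ℕ) → β} (hf : FinDep f) (g : β → γ) :
    FinDep fun y => g (f y) :=
  let ⟨S, hS⟩ := hf
  ⟨S, fun _ _ hab => congrArg g (hS hab)⟩

theorem FinDep.eventually_comp [LinearOrder I] {P : (I → ℕ) → Prop} (hP : FinDep P) (α : I ≃o I) :
    (∀ᶠ y in limitUltrafilter I, P (y ∘ α)) ↔ ∀ᶠ y in limitUltrafilter I, P y :=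
  let ⟨_, hS⟩ := hP
  eventually_limitUltrafilter_comp hS α

theorem FinDep.eq {β : Type*} {f g : (I → ℕ) → β} (hf : FinDep f) (hg : FinDep g) :
    FinDep fun y => f y = g y :=
  (FinDep.pi (f := ![f, g]) (fun k => by fin_cases k <;> assumption)).map fun p => p 0 = p 1

end FinDep

/-! ### The submodel of finitely dependent germs -/

section model

open FirstOrder FirstOrder.Language
open FirstOrder.Language.Structure (funMap RelMap)

variable (L : FirstOrder.Language.{u, v}) (M : Type w) [L.Structure M] (I : Type x) [LinearOrder I]

/-- The ultrapower of `M` modulo `limitUltrafilter I`. -/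
abbrev Ultrapower : Type (max w x) :=
  (limitUltrafilter I : Filter (I → ℕ)).Product fun _ => M

variable {M I}

/-- The class of a function in the ultrapower. -/
noncomputable def germ (f : (I → ℕ) → M) : Ultrapower M I :=
  Quotient.mk ((limitUltrafilter I : Filter (I → ℕ)).productSetoid fun _ => M) f

theorem germ_eq_germ {f g : (I → ℕ) → M} :
    germ f = germ g ↔ ∀ᶠ y in limitUltrafilter I, f y = g y := Quotient.eq

theorem funMap_germ {n : ℕ} (F : L.Functions n) (f : Fin n → (I → ℕ) → M) :
    funMap F (fun k => germ (f k)) = germ fun y => funMap F fun k => f k y :=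
  Ultraproduct.funMap_cast F f

theorem relMap_germ {n : ℕ} (R : L.Relations n) (f : Fin n → (I → ℕ) → M) :
    RelMap R (fun k => germ (f k)) ↔ ∀ᶠ y in limitUltrafilter I, RelMap R fun k => f k y :=
  FirstOrder.Language.relMap_quotient_mk' ((limitUltrafilter I : Filter (I → ℕ)).productSetoid _) R f

variable (M I)

/-- The iterated ultrapower of `M` along `I`: the germs of functions depending on finitely many
coordinates, as a substructure of the ultrapower. -/
def iteratedUltrapower : L.Substructure (Ultrapower M I) where
  carrier := {z | ∃ f, FinDep f ∧ germ f = z}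
  fun_mem F z hz := by
    choose f hf hfz using hz
    obtain rfl : (fun k => germ (f k)) = z := funext hfz
    exact ⟨_, (FinDep.pi hf).map _, (funMap_germ L F f).symm⟩

variable {M I}

/-- The element of the iterated ultrapower given by a function. -/
noncomputable def mk {f : (I → ℕ) → M} (hf : FinDep f) : iteratedUltrapower L M I :=
  ⟨germ f, f, hf, rfl⟩

variable {L}

theorem exists_mk_eq (z : iteratedUltrapower L M I) :
    ∃ (f : (I → ℕ) → M) (hf : FinDep f), mk L hf = z :=
  let ⟨_, f, hf, h⟩ := z
  ⟨f, hf, Subtype.ext h⟩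

theorem mk_eq_mk {f g : (I → ℕ) → M} {hf : FinDep f} {hg : FinDep g} :
    mk L hf = mk L hg ↔ ∀ᶠ y in limitUltrafilter I, f y = g y :=
  Subtype.ext_iff.trans germ_eq_germ

theorem funMap_mk {n : ℕ} (F : L.Functions n) {f : Fin n → (I → ℕ) → M} (hf : ∀ k, FinDep (f k)) :
    funMap F (fun k => mk L (hf k)) = mk L ((FinDep.pi hf).map (funMap F)) :=
  Subtype.ext (funMap_germ L F f)

theorem relMap_mk {n : ℕ} (R : L.Relations n) {f : Fin n → (I → ℕ) → M} (hf : ∀ k, FinDep (f k)) :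
    RelMap R (fun k => mk L (hf k)) ↔ ∀ᶠ y in limitUltrafilter I, RelMap R fun k => f k y :=
  relMap_germ L R f

section elementary

variable [Nonempty M]

variable (L M I) in
/-- The Tarski–Vaught test holds because, by Łoś's theorem, a witness may be chosen pointwise as a
function of the parameters. -/
theorem isElementary_iteratedUltrapower : (iteratedUltrapower L M I).IsElementary := by
  refine Substructure.isElementary_of_exists _ fun n φ z a h => ?_
  choose f hf hfz using fun k => exists_mk_eq (z k)
  obtain rfl : (fun k => mk L (hf k)) = z := funext hfz
  induction a using Quotient.inductionOn' with | _ a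
  have los (b : (I → ℕ) → M) :
      φ.Realize default (Fin.snoc ((↑) ∘ fun k => mk L (hf k)) (germ b) : _ → Ultrapower M I) ↔
        ∀ᶠ y in limitUltrafilter I, φ.Realize default (Fin.snoc (fun k => f k y) (b y)) := by
    have key : φ.Realize (fun e : Empty => germ (e.elim : (I → ℕ) → M))
        (fun k => germ ((Fin.snoc f b : Fin (n + 1) → (I → ℕ) → M) k)) ↔
        ∀ᶠ y in limitUltrafilter I, φ.Realize (fun e : Empty => (e.elim : (I → ℕ) → M) y)
          (fun k => (Fin.snoc f b : Fin (n + 1) → (I → ℕ) → M) k y) :=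
      Ultraproduct.boundedFormula_realize_cast (u := limitUltrafilter I) φ _ _
    have h1 : (Fin.snoc ((↑) ∘ fun k => mk L (hf k)) (germ b) : _ → Ultrapower M I) =
        fun k => germ ((Fin.snoc f b : Fin (n + 1) → (I → ℕ) → M) k) :=
      funext <| Fin.lastCases (by simp) fun k => by simp [mk]
    have h2 (y : I → ℕ) : (Fin.snoc (fun k => f k y) (b y) : Fin (n + 1) → M) =
        fun k => (Fin.snoc f b : Fin (n + 1) → (I → ℕ) → M) k y :=
      funext <| Fin.lastCases (by simp) fun k => by simp
    simp only [h1, h2]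
    convert key
  let choice (p : Fin n → M) : M := Classical.epsilon fun m => φ.Realize default (Fin.snoc p m)
  refine ⟨mk L ((FinDep.pi hf).map choice), (los _).2 ?_⟩
  exact ((los a).1 h).mono fun y hy => Classical.epsilon_spec (p := fun m =>
    φ.Realize default (Fin.snoc (fun k => f k y) m)) ⟨_, hy⟩

variable (L M I) in
/-- The embedding of `M` into its iterated ultrapower by constant functions. -/
noncomputable def diagonal : M ↪ₑ[L] iteratedUltrapower L M I where
  toFun m := mk L (FinDep.const m)
  map_formula' n φ v := by
    have h1 := isElementary_iteratedUltrapower L M I φ fun k => mk L (FinDep.const (v k))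
    have h2 := Ultraproduct.realize_formula_cast (u := limitUltrafilter I) φ
      (fun k (_ : I → ℕ) => v k)
    exact h1.symm.trans (h2.trans eventually_const)

theorem diagonal_apply (m : M) : diagonal L M I m = mk L (FinDep.const m) := rfl

end elementary

/-! ### The action of order automorphisms -/

theorem exists_action (α : I ≃o I) (z : iteratedUltrapower L M I) :
    ∃ z' : iteratedUltrapower L M I, ∀ (f : (I → ℕ) → M) (hf : FinDep f), mk L hf = z →
      z' = mk L (hf.comp_orderIso α) := by
  obtain ⟨f, hf, rfl⟩ := exists_mk_eq z
  refine ⟨mk L (hf.comp_orderIso α), fun g hg h => ?_⟩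
  rw [mk_eq_mk] at h ⊢
  filter_upwards [((hg.eq hf).eventually_comp α).2 h] with y hy using hy.symm

/-- An order automorphism `α` of `I` acts on the iterated ultrapower by precomposing with
`y ↦ y ∘ α`. -/
noncomputable def action (α : I ≃o I) (z : iteratedUltrapower L M I) : iteratedUltrapower L M I :=
  (exists_action α z).choose

theorem action_mk (α : I ≃o I) {f : (I → ℕ) → M} (hf : FinDep f) :
    action α (mk L hf) = mk L (hf.comp_orderIso α) :=
  (exists_action α (mk L hf)).choose_spec f hf rfl

theorem action_one (z : iteratedUltrapower L M I) : action 1 z = z := by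
  obtain ⟨f, hf, rfl⟩ := exists_mk_eq z
  exact action_mk 1 hf

theorem action_mul (α β : I ≃o I) (z : iteratedUltrapower L M I) :
    action (α * β) z = action α (action β z) := by
  obtain ⟨f, hf, rfl⟩ := exists_mk_eq z
  rw [action_mk, action_mk, action_mk]
  rfl

variable (L M I) in
/-- The action of the order automorphisms of `I` by automorphisms of the iterated ultrapower. -/
noncomputable def actionHom :
    (I ≃o I) →* (iteratedUltrapower L M I ≃[L] iteratedUltrapower L M I) where
  toFun α :=
    { toFun := action α
      invFun := action α⁻¹
      left_inv := fun z => by rw [← action_mul, inv_mul_cancel, action_one]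
      right_inv := fun z => by rw [← action_mul, mul_inv_cancel, action_one]
      map_fun' := fun F z => by
        choose f hf hfz using fun k => exists_mk_eq (z k)
        obtain rfl : (fun k => mk L (hf k)) = z := funext hfz
        have : action α ∘ (fun k => mk L (hf k)) = fun k => mk L ((hf k).comp_orderIso α) :=
          funext fun k => action_mk α (hf k)
        rw [this, funMap_mk, funMap_mk, action_mk]
      map_rel' := fun R z => by
        choose f hf hfz using fun k => exists_mk_eq (z k)
        obtain rfl : (fun k => mk L (hf k)) = z := funext hfz
        have : action α ∘ (fun k => mk L (hf k)) = fun k => mk L ((hf k).comp_orderIso α) :=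
          funext fun k => action_mk α (hf k)
        rw [this, relMap_mk, relMap_mk]
        exact ((FinDep.pi hf).map (RelMap R)).eventually_comp α }
  map_one' := FirstOrder.Language.Equiv.ext action_one
  map_mul' α β := FirstOrder.Language.Equiv.ext (action_mul α β)

theorem actionHom_mk (α : I ≃o I) {f : (I → ℕ) → M} (hf : FinDep f) :
    actionHom L M I α (mk L hf) = mk L (hf.comp_orderIso α) := action_mk α hf

section diagonal

variable [Nonempty M]

theorem actionHom_diagonal (α : I ≃o I) (m : M) :
    actionHom L M I α (diagonal L M I m) = diagonal L M I m :=
  actionHom_mk α (FinDep.const m)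

theorem mem_range_diagonal_of_actionHom_eq {α : I ≃o I} (hα : ∀ i, α i ≠ i)
    {z : iteratedUltrapower L M I} (hz : actionHom L M I α z = z) :
    z ∈ Set.range (diagonal L M I) := by
  obtain ⟨f, hf, rfl⟩ := exists_mk_eq z
  have ⟨S, hS⟩ := hf
  obtain ⟨m, hm⟩ := exists_iterate_disjoint α hα S
  have hpow (m : ℕ) : actionHom L M I (α ^ m) (mk L hf) = mk L hf := by
    induction m with
    | zero => rw [pow_zero, map_one]; rfl
    | succ m ih =>
      rw [pow_succ, map_mul]
      exact (congrArg (actionHom L M I (α ^ m)) hz).trans ih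
  have h := mk_eq_mk.1 ((actionHom_mk (α ^ m) hf).symm.trans (hpow m))
  obtain ⟨c, hc⟩ := exists_eventually_limitUltrafilter_eq_const
    (dependsOn_comp_orderIso hS (α ^ m)) hS hm.symm h
  refine ⟨c, (mk_eq_mk (hf := FinDep.const c) (hg := hf)).2 ?_⟩
  filter_upwards [h, hc] with y h1 h2 using h2.symm.trans h1

end diagonal

section infinite

variable [Infinite M]

theorem not_eventually_natEmbedding_eq (i : I) (c : M) :
    ¬ ∀ᶠ y : I → ℕ in limitUltrafilter I, Infinite.natEmbedding M (y i) = c := by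
  intro h
  obtain ⟨y₀, hy₀⟩ := h.exists
  refine not_eventually_limitUltrafilter_apply_eq i (y₀ i) (h.mono fun y hy => ?_)
  exact (Infinite.natEmbedding M).injective (hy.trans hy₀.symm)

theorem not_surjective_diagonal [Nonempty I] : ¬ Surjective (diagonal L M I) := by
  intro h
  let i : I := Classical.arbitrary I
  obtain ⟨c, hc⟩ := h (mk L (FinDep.apply i (Infinite.natEmbedding M)))
  rw [diagonal_apply, mk_eq_mk] at hc
  exact not_eventually_natEmbedding_eq i c (hc.mono fun y hy => hy.symm)

variable (L M I) in
theorem injective_actionHom : Injective (actionHom L M I) := by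
  rw [injective_iff_map_eq_one]
  intro α hα
  ext i
  by_contra hi
  have h : actionHom L M I α (mk L (FinDep.apply i (Infinite.natEmbedding M))) =
      mk L (FinDep.apply i (Infinite.natEmbedding M)) := by rw [hα]; rfl
  rw [actionHom_mk, mk_eq_mk] at h
  have hd (j : I) : DependsOn (fun y : I → ℕ => Infinite.natEmbedding M (y j))
      ({j} : Finset I) := fun a b hab => by simp only [hab j (by simp)]
  obtain ⟨c, hc⟩ := exists_eventually_limitUltrafilter_eq_const (hd (α i)) (hd i)
    (Finset.disjoint_singleton.2 hi) h
  exact not_eventually_natEmbedding_eq _ c hc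

end infinite

end model

end IteratedUltrapower

theorem theorem2p4 (L : FirstOrder.Language.{u, v}) (M : Type w) [L.Structure M] [Infinite M]
    (I : Type x) [LinearOrder I] [Nonempty I] :
    ∃ (N : Type (max w x)) (_ : L.Structure N) (j : M ↪ₑ[L] N)
      (F : (I ≃o I) →* (N ≃[L] N)),
      -- the elementary extension is proper
      ¬ Function.Surjective j ∧
      -- the homomorphism of automorphism groups is an embedding
      Function.Injective F ∧
      -- every automorphism in the image fixes the base structure pointwise
      (∀ (α : I ≃o I) (m : M), F α (j m) = j m) ∧
      -- fixed point free automorphisms move everything outside the base structure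
      (∀ α : I ≃o I, (∀ i : I, α i ≠ i) → ∀ y : N, y ∉ Set.range j → F α y ≠ y) := by
  exact ⟨IteratedUltrapower.iteratedUltrapower L M I, inferInstance,
    IteratedUltrapower.diagonal L M I, IteratedUltrapower.actionHom L M I,
    IteratedUltrapower.not_surjective_diagonal, IteratedUltrapower.injective_actionHom L M I,
    IteratedUltrapower.actionHom_diagonal, fun _ hα _ hy h =>
      hy (IteratedUltrapower.mem_range_diagonal_of_actionHom_eq hα h)⟩
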